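/- Let $\sigma_1,\dots,\sigma_d$ be real numbers (for instance the singular values of a matrix), $k\ge 0$ an integer, and $\beta_l=(\sigma_l^{2k})^2$. Fix $i$ with $\beta_i>0$ and $\sum_{l\ne i}\beta_l>0$. For $y\sim\mathcal N(0,I_d)$ put $$\lambda_i(k)=\mathbb E\,\frac{(y_i\sigma_i^{2k})^2}{\sum_{l=1}^{d}(y_l\sigma_l^{2k})^2},\qquad u=y_i^2,\qquad v_i=\sum_{l\ne i}\frac{\beta_l}{\beta_i}y_l^2,$$ $$\alpha_i=\frac12\,\frac{(\sum_{l\ne i}\beta_l)^2}{\sum_{l\ne i}\beta_l^2},\qquad \gamma_i=\frac1{\beta_i}\,\frac{\sum_{l\ne i}\beta_l^2}{\sum_{l\ne i}\beta_l},$$ and let $\mathcal G(a,\theta)$ denote the Gamma distribution with shape $a$ and scale $\theta$. Then: (1) $\alpha_i,\gamma_i>0$ and, exactly, $\lambda_i(k)=\mathbb E\frac{\beta_iy_i^2}{\beta_iy_i^2+\sum_{l\ne i}\beta_ly_l^2}=\mathbb E\frac{u}{u+v_i}$, where $u\sim\mathcal G(\tfrac12,2)$ is independent of $v_i$; moreover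 $v_i$ has finite second moment and the same mean and variance as $\mathcal G(\alpha_i,2\gamma_i)$. (2) Replace $v_i$ by its moment-matching Gamma surrogate: let $U\sim\mathcal G(\tfrac12,2)$ and $V\sim\mathcal G(\alpha_i,2\gamma_i)$ be independent random variables on any probability space. Then $z=U/(U+V)$ has the probability density $$x_i^\bullet(z)=\frac{\gamma_i}{(1-(1-\gamma_i)z)^2}\;\mathcal B\!\Big(\frac{\gamma_i z}{1-(1-\gamma_i)z};\tfrac12,\alpha_i\Big),$$ where $\mathcal B(\,\cdot\,;\tfrac12,\alpha_i)$ is the density of the Beta$(\tfrac12,\alpha_i)$ distribution (zero outside $(0,1)$); $x_i^\bullet$ is nonnegative with support $[0,1]$, and $$\mathbb E\frac{U}{U+V}=\int_0^1 z\,x_i^\bullet(z)\,dz=\gamma_i^{1/2}\,\frac{\Gamma(\frac32)\Gamma(\frac12+\alpha_i)}{\Gamma(\frac12)\Gamma(\frac32+\alpha_i)}\;{}_2F_1\!\big(\tfrac32,\tfrac12+\alpha_i;\tfrac32+\alpha_i;1-\gamma_i\big),$$ where ${}_2F_1$ is Gauss's hypergeometric function, i.e. the analytic continuation of the hypergeometric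 series to $\mathbb C\setminus[1,\infty)$. (3) In particular, whenever $v_i$ itself has the law $\mathcal G(\alpha_i,2\gamma_i)$, the number $\lambda_i(k)$ equals the expression in (2). -/

import Mathlib

open MeasureTheory ProbabilityTheory Set

noncomputable section

namespace SpectralAug

/-- The standard normal law `N(0, I)` on `ℝ^d`: i.i.d. standard normal coordinates. -/
def stdNormal (d : ℕ) : Measure (Fin d → ℝ) := Measure.pi fun _ => gaussianReal 0 1

/-- The Gamma distribution with shape `a` and *scale* `θ` (Mathlib's is parametrized by the
rate `1 / θ`). -/
def gammaScale (a θ : ℝ) : Measure ℝ := gammaMeasure a θ⁻¹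

/-- `βᵢ = (σᵢ^{2k})²`. -/
def beta {d : ℕ} (σ : Fin d → ℝ) (k : ℕ) (i : Fin d) : ℝ := (σ i ^ (2 * k)) ^ 2

/-- `λᵢ(k) = E_{y ∼ N(0, I)} [(yᵢ σᵢ^{2k})² / ∑ₗ (yₗ σₗ^{2k})²]`. -/
def lam {d : ℕ} (σ : Fin d → ℝ) (k : ℕ) (i : Fin d) : ℝ :=
  ∫ y, (y i * σ i ^ (2 * k)) ^ 2 / ∑ l, (y l * σ l ^ (2 * k)) ^ 2 ∂stdNormal d

/-- `u = yᵢ²`. -/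
def uVar {d : ℕ} (i : Fin d) (y : Fin d → ℝ) : ℝ := y i ^ 2

/-- `vᵢ = ∑_{l ≠ i} (βₗ / βᵢ) yₗ²`. -/
def vVar {d : ℕ} (σ : Fin d → ℝ) (k : ℕ) (i : Fin d) (y : Fin d → ℝ) : ℝ :=
  ∑ l ∈ Finset.univ.erase i, beta σ k l / beta σ k i * y l ^ 2

/-- `αᵢ = (1/2) (∑_{l ≠ i} βₗ)² / ∑_{l ≠ i} βₗ²`. -/
def alpha {d : ℕ} (σ : Fin d → ℝ) (k : ℕ) (i : Fin d) : ℝ :=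
  1 / 2 * ((∑ l ∈ Finset.univ.erase i, beta σ k l) ^ 2 /
    ∑ l ∈ Finset.univ.erase i, beta σ k l ^ 2)

/-- `γᵢ = (1/βᵢ) (∑_{l ≠ i} βₗ²) / ∑_{l ≠ i} βₗ`. -/
def gam {d : ℕ} (σ : Fin d → ℝ) (k : ℕ) (i : Fin d) : ℝ :=
  1 / beta σ k i * ((∑ l ∈ Finset.univ.erase i, beta σ k l ^ 2) /
    ∑ l ∈ Finset.univ.erase i, beta σ k l)

/-- The density
`x•(z) = γ / (1 - (1 - γ) z)² * B(γ z / (1 - (1 - γ) z); 1/2, α)`,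
where `B( · ; 1/2, α)` is the density of the Beta distribution (zero outside `(0, 1)`). -/
def xPDF (α γ z : ℝ) : ℝ :=
  γ / (1 - (1 - γ) * z) ^ 2 * betaPDFReal (1 / 2) α (γ * z / (1 - (1 - γ) * z))

/-- The plane cut along `[1, ∞)`. -/
def cutPlane : Set ℂ := {z | 1 - z ∈ Complex.slitPlane}

/-- `F` is holomorphic on `ℂ \ [1, ∞)` and is the sum of Gauss's hypergeometric series
`∑ₙ (a)ₙ (b)ₙ / (c)ₙ * zⁿ / n!` on the unit disc. -/
structure IsGaussHypergeometric (a b c : ℂ) (F : ℂ → ℂ) : Prop where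
  differentiableOn : DifferentiableOn ℂ F cutPlane
  eq_series : ∀ z : ℂ, ‖z‖ < 1 → F z = ₂F₁ a b c z

open Classical in
/-- Gauss's hypergeometric function `₂F₁(a, b; c; z)` on `ℂ \ [1, ∞)`: the analytic continuation
of the hypergeometric series. (If there were no continuation, the value would be `0`; values on
the cut are not meaningful.) -/
def hyp2F1 (a b c : ℂ) : ℂ → ℂ :=
  if h : ∃ F, IsGaussHypergeometric a b c F then h.choose else 0

/-- The continuation is unique, so `hyp2F1` does not depend on a choice on `ℂ \ [1, ∞)`. -/
theorem IsGaussHypergeometric.eqOn {a b c : ℂ} {F : ℂ → ℂ}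
    (hF : IsGaussHypergeometric a b c F) : EqOn (hyp2F1 a b c) F cutPlane := by
  have hex : ∃ F, IsGaussHypergeometric a b c F := ⟨F, hF⟩
  have hG : IsGaussHypergeometric a b c (hyp2F1 a b c) := by
    rw [hyp2F1, dif_pos hex]
    exact hex.choose_spec
  have hopen : IsOpen cutPlane :=
    Complex.isOpen_slitPlane.preimage (continuous_const.sub continuous_id)
  have hstar : StarConvex ℝ (0 : ℂ) cutPlane := by
    intro z hz s t hs ht hst
    have h := Complex.starConvex_one_slitPlane hz hs ht hst
    have e : (1 : ℂ) - (s • (0 : ℂ) + t • z) = s • (1 : ℂ) + t • (1 - z) := by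
      have hst' : (s : ℂ) + t = 1 := by exact_mod_cast hst
      simp only [Complex.real_smul]
      linear_combination -hst'
    change (1 : ℂ) - (s • (0 : ℂ) + t • z) ∈ Complex.slitPlane
    rw [e]
    exact h
  have h0 : (0 : ℂ) ∈ cutPlane := by simp [cutPlane]
  refine AnalyticOnNhd.eqOn_of_preconnected_of_eventuallyEq
    (hG.differentiableOn.analyticOnNhd hopen) (hF.differentiableOn.analyticOnNhd hopen)
    (hstar.isPathConnected h0).isConnected.isPreconnected h0 ?_
  filter_upwards [Metric.ball_mem_nhds (0 : ℂ) one_pos] with z hz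
  have hz' : ‖z‖ < 1 := by simpa using hz
  rw [hG.eq_series z hz', hF.eq_series z hz']

end SpectralAug

end

/-!
For independent `U ∼ Γ(a, θ)` and `W ∼ Γ(b, θ)` on the same scale, `U / (U + W)` has the Beta law
with parameters `a` and `b`. Passing to `V = γ W` divides the odds of the ratio by `γ`, which is a
Möbius map of `(0, 1)`, so that `x•` is the Beta density after this change of variables. The mean
of `x•` is then an Euler integral `∫ (1 - z t)^(-c) dμ(t)` of a Beta law `μ` at `z = 1 - γ`. Such an
integral is holomorphic on the cut plane, and integrating the binomial series termwise against the
moments of `μ` gives the hypergeometric series: it is the continuation of that series.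

The surrogate of `vᵢ` comes from the mean `∑ w` and the variance `2 ∑ w²` of a weighted sum of
independent `χ²₁` variables, to be compared with `a θ` and `a θ²`.
-/

noncomputable section

namespace SpectralAug

section ChangeOfVariables

theorem map_withDensity_indicator_of_invOn {s t : Set ℝ} {φ φ' ψ : ℝ → ℝ} (p : ℝ → ENNReal)
    (hs : MeasurableSet s) (ht : MeasurableSet t) (hψ_meas : Measurable ψ)
    (hφ' : ∀ z ∈ s, HasDerivWithinAt φ (φ' z) s z) (hinv : InvOn ψ φ s t)
    (hφ : MapsTo φ s t) (hψ : MapsTo ψ t s) :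
    (volume.withDensity (t.indicator p)).map ψ =
      volume.withDensity (s.indicator fun z => ENNReal.ofReal |φ' z| * p (φ z)) := by
  ext A hA
  have himage : t ∩ ψ ⁻¹' A = φ '' (s ∩ A) := by
    rw [inter_comm s, hinv.1.image_inter', (hinv.bijOn hφ hψ).image_eq, inter_comm]
  rw [Measure.map_apply hψ_meas hA, withDensity_apply _ (hψ_meas hA), withDensity_apply _ hA,
    setLIntegral_indicator ht, setLIntegral_indicator hs, himage]
  exact lintegral_image_eq_lintegral_abs_deriv_mul (hs.inter hA)
    (fun z hz => (hφ' z hz.1).mono inter_subset_left) (hinv.1.injOn.mono inter_subset_left) p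

theorem lintegral_eq_two_mul_setLIntegral_Ioi {f : ℝ → ENNReal} (hf : Function.Even f) :
    ∫⁻ x, f x = 2 * ∫⁻ x in Ioi 0, f x := by
  have hneg : ∫⁻ x in Iio 0, f x = ∫⁻ x in Ioi 0, f x := by
    have h := (Measure.measurePreserving_neg (volume : Measure ℝ)).setLIntegral_comp_preimage_emb
      (MeasurableEquiv.neg ℝ).measurableEmbedding f (Iio 0)
    simpa [hf _] using h.symm
  rw [← lintegral_add_compl f (measurableSet_Iio (a := (0 : ℝ))), compl_Iio,
    ← restrict_Ioi_eq_restrict_Ici, hneg, two_mul]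

theorem map_withDensity_of_even {p : ℝ → ENNReal} {g : ℝ → ℝ} (hg_meas : Measurable g)
    (hp : Function.Even p) (hg : Function.Even g) :
    (volume.withDensity p).map g =
      (volume.withDensity ((Ioi 0).indicator fun x => 2 * p x)).map g := by
  ext A hA
  have heven : Function.Even ((g ⁻¹' A).indicator p) := fun x => by
    by_cases hx : g x ∈ A <;> simp [hx, hg x, hp x]
  rw [Measure.map_apply hg_meas hA, Measure.map_apply hg_meas hA,
    withDensity_apply _ (hg_meas hA), withDensity_apply _ (hg_meas hA),
    ← lintegral_indicator (hg_meas hA), lintegral_eq_two_mul_setLIntegral_Ioi heven,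
    setLIntegral_indicator (hg_meas hA), setLIntegral_indicator measurableSet_Ioi,
    lintegral_const_mul' _ _ (by simp), inter_comm]

theorem integral_withDensity_ofReal {α E : Type*} [MeasurableSpace α] [NormedAddCommGroup E]
    [NormedSpace ℝ E] {μ : Measure α} {f : α → ℝ} (hf : Measurable f) (hf0 : ∀ x, 0 ≤ f x)
    (g : α → E) :
    ∫ x, g x ∂μ.withDensity (fun x => ENNReal.ofReal (f x)) = ∫ x, f x • g x ∂μ := by
  rw [integral_withDensity_eq_integral_toReal_smul hf.ennreal_ofReal
    (ae_of_all _ fun _ => ENNReal.ofReal_lt_top)]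
  simp only [ENNReal.toReal_ofReal (hf0 _)]

theorem integrable_withDensity_ofReal_iff {α E : Type*} [MeasurableSpace α]
    [NormedAddCommGroup E] [NormedSpace ℝ E] {μ : Measure α} {f : α → ℝ} (hf : Measurable f)
    (hf0 : ∀ x, 0 ≤ f x) {g : α → E} :
    Integrable g (μ.withDensity fun x => ENNReal.ofReal (f x)) ↔
      Integrable (fun x => f x • g x) μ := by
  rw [integrable_withDensity_iff_integrable_smul' hf.ennreal_ofReal
    (ae_of_all _ fun _ => ENNReal.ofReal_lt_top)]
  simp only [ENNReal.toReal_ofReal (hf0 _)]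

end ChangeOfVariables

section Gamma

variable {a b r : ℝ}

@[fun_prop]
theorem measurable_gammaPDF (a r : ℝ) : Measurable (gammaPDF a r) :=
  (measurable_gammaPDFReal a r).ennreal_ofReal

theorem gammaMeasure_eq_withDensity_indicator (a r : ℝ) :
    gammaMeasure a r = volume.withDensity ((Ioi 0).indicator (gammaPDF a r)) := by
  refine withDensity_congr_ae ?_
  filter_upwards [Measure.ae_ne volume (0 : ℝ)] with x hx
  rcases hx.lt_or_gt with hx | hx
  · rw [gammaPDF_of_neg hx, indicator_of_notMem (notMem_Ioi.2 hx.le)]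
  · rw [indicator_of_mem (mem_Ioi.2 hx)]

theorem ae_nonneg_gammaMeasure (a r : ℝ) : ∀ᵐ t ∂gammaMeasure a r, 0 ≤ t := by
  rw [gammaMeasure, ae_withDensity_iff (measurable_gammaPDF a r)]
  exact ae_of_all _ fun t ht => not_lt.1 fun hneg => ht (gammaPDF_of_neg hneg)

theorem setLIntegral_Ioi_gammaPDF (ha : 0 < a) (hr : 0 < r) :
    ∫⁻ t in Ioi 0, gammaPDF a r t = 1 := by
  have := isProbabilityMeasure_gammaMeasure ha hr
  have h : gammaMeasure a r univ = 1 := measure_univ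
  rwa [gammaMeasure_eq_withDensity_indicator, withDensity_apply _ .univ, Measure.restrict_univ,
    lintegral_indicator measurableSet_Ioi] at h

theorem integral_gammaPDFReal (ha : 0 < a) (hr : 0 < r) : ∫ t, gammaPDFReal a r t = 1 := by
  have := isProbabilityMeasure_gammaMeasure ha hr
  have hmass : ∫ _, (1 : ℝ) ∂gammaMeasure a r = ∫ t, gammaPDFReal a r t • (1 : ℝ) :=
    integral_withDensity_ofReal (measurable_gammaPDFReal a r) (gammaPDFReal_nonneg ha hr) _
  simpa using hmass.symm

theorem gammaPDFReal_mul_rpow {s t : ℝ} (ha : 0 < a) (hr : 0 < r) (has : 0 < a + s)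
    (ht : t ≠ 0) :
    gammaPDFReal a r t * t ^ s =
      Real.Gamma (a + s) / (Real.Gamma a * r ^ s) * gammaPDFReal (a + s) r t := by
  unfold gammaPDFReal
  split_ifs with h
  · have ht : 0 < t := h.lt_of_ne' ht
    have := Real.Gamma_pos_of_pos ha
    have := Real.Gamma_pos_of_pos has
    rw [add_sub_right_comm, Real.rpow_add ht, Real.rpow_add hr]
    field_simp
  · simp

theorem ae_gammaPDFReal_mul_rpow {s : ℝ} (ha : 0 < a) (hr : 0 < r) (has : 0 < a + s) :
    (fun t => gammaPDFReal a r t * t ^ s) =ᵐ[volume]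
      fun t => Real.Gamma (a + s) / (Real.Gamma a * r ^ s) * gammaPDFReal (a + s) r t := by
  filter_upwards [Measure.ae_ne volume 0] with t ht using gammaPDFReal_mul_rpow ha hr has ht

theorem integral_rpow_gammaMeasure {s : ℝ} (ha : 0 < a) (hr : 0 < r) (has : 0 < a + s) :
    ∫ t, t ^ s ∂gammaMeasure a r = Real.Gamma (a + s) / (Real.Gamma a * r ^ s) := by
  calc ∫ t, t ^ s ∂gammaMeasure a r
      = ∫ t, gammaPDFReal a r t * t ^ s :=
        integral_withDensity_ofReal (measurable_gammaPDFReal a r) (gammaPDFReal_nonneg ha hr) _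
    _ = Real.Gamma (a + s) / (Real.Gamma a * r ^ s) := by
        rw [integral_congr_ae (ae_gammaPDFReal_mul_rpow ha hr has), integral_const_mul,
          integral_gammaPDFReal has hr, mul_one]

theorem integrable_rpow_gammaMeasure {s : ℝ} (ha : 0 < a) (hr : 0 < r) (has : 0 < a + s) :
    Integrable (fun t : ℝ => t ^ s) (gammaMeasure a r) := by
  refine .of_integral_ne_zero ?_
  have := Real.Gamma_pos_of_pos ha
  have := Real.Gamma_pos_of_pos has
  rw [integral_rpow_gammaMeasure ha hr has]
  positivity

theorem map_const_mul_gammaMeasure {c : ℝ} (hr : 0 < r) (hc : 0 < c) :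
    (gammaMeasure a r).map (c * ·) = gammaMeasure a (r / c) := by
  have hpdf : ∀ z ∈ Ioi (0 : ℝ),
      ENNReal.ofReal |c⁻¹| * gammaPDF a r (c⁻¹ * z) = gammaPDF a (r / c) z := fun z hz => by
    have hz : 0 < z := hz
    rw [abs_of_pos (by positivity), gammaPDF_of_nonneg (by positivity),
      gammaPDF_of_nonneg hz.le, ← ENNReal.ofReal_mul (by positivity), Real.div_rpow hr.le hc.le,
      Real.mul_rpow (by positivity) hz.le, Real.inv_rpow hc.le, Real.rpow_sub_one hc.ne',
      show r / c * z = r * (c⁻¹ * z) by ring]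
    congr 1
    field_simp
  rw [gammaMeasure_eq_withDensity_indicator, gammaMeasure_eq_withDensity_indicator,
    map_withDensity_indicator_of_invOn (φ := (c⁻¹ * ·)) (φ' := fun _ => c⁻¹) (s := Ioi 0) _
      measurableSet_Ioi measurableSet_Ioi (by fun_prop) (fun z _ => by
        simpa using ((hasDerivAt_id z).const_mul c⁻¹).hasDerivWithinAt)
      ⟨fun z _ => mul_inv_cancel_left₀ hc.ne' z, fun z _ => inv_mul_cancel_left₀ hc.ne' z⟩
      (fun z hz => mul_pos (inv_pos.2 hc) hz) (fun z hz => mul_pos hc hz),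
    indicator_congr hpdf]

theorem two_mul_gaussianPDF_sqrt {z : ℝ} (hz : 0 < z) :
    ENNReal.ofReal |1 / (2 * √z)| * (2 * gaussianPDF 0 1 √z) = gammaPDF (1 / 2) 2⁻¹ z := by
  have := Real.sqrt_pos.2 hz
  have hexponent : z ^ (1 / 2 - 1 : ℝ) = (√z)⁻¹ := by
    rw [Real.sqrt_eq_rpow, ← Real.rpow_neg hz.le]
    norm_num
  rw [gammaPDF_of_nonneg hz.le, gaussianPDF, gaussianPDFReal, abs_of_pos (by positivity),
    ← ENNReal.ofReal_ofNat 2, ← ENNReal.ofReal_mul (by norm_num),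
    ← ENNReal.ofReal_mul (by positivity), Real.Gamma_one_half_eq, hexponent,
    ← Real.sqrt_eq_rpow, Real.sqrt_inv]
  have := Real.pi_pos
  simp only [NNReal.coe_one, mul_one, sub_zero, Real.sq_sqrt hz.le,
    Real.sqrt_mul (zero_le_two (α := ℝ))]
  rw [show -z / 2 = -(2⁻¹ * z) by ring]
  congr 1
  field_simp

theorem map_sq_gaussianReal :
    (gaussianReal 0 1).map (fun x => x ^ 2) = gammaMeasure (1 / 2) 2⁻¹ := by
  have hpdf_even : Function.Even (gaussianPDF 0 1) := fun x => by
    simp [gaussianPDF, gaussianPDFReal]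
  rw [gaussianReal_of_var_ne_zero _ one_ne_zero,
    map_withDensity_of_even (by fun_prop) hpdf_even (fun x => neg_sq x),
    map_withDensity_indicator_of_invOn (φ := Real.sqrt) (φ' := fun z => 1 / (2 * √z))
      (s := Ioi 0) _ measurableSet_Ioi measurableSet_Ioi (by fun_prop)
      (fun z hz => (Real.hasDerivAt_sqrt (ne_of_gt hz)).hasDerivWithinAt)
      ⟨fun z hz => Real.sq_sqrt (le_of_lt hz), fun x hx => Real.sqrt_sq (le_of_lt hx)⟩
      (fun z hz => Real.sqrt_pos.2 hz) (fun x hx => pow_pos (mem_Ioi.1 hx) 2),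
    indicator_congr fun z hz => two_mul_gaussianPDF_sqrt (mem_Ioi.1 hz),
    gammaMeasure_eq_withDensity_indicator]

end Gamma

section GammaScale

variable {a θ : ℝ}

theorem isProbabilityMeasure_gammaScale (ha : 0 < a) (hθ : 0 < θ) :
    IsProbabilityMeasure (gammaScale a θ) :=
  isProbabilityMeasure_gammaMeasure ha (inv_pos.2 hθ)

theorem integral_id_gammaScale (ha : 0 < a) (hθ : 0 < θ) :
    ∫ t, t ∂gammaScale a θ = a * θ := by
  have hmoment := integral_rpow_gammaMeasure (s := 1) ha (inv_pos.2 hθ) (by positivity)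
  simp only [Real.rpow_one, Real.Gamma_add_one ha.ne'] at hmoment
  have := Real.Gamma_pos_of_pos ha
  rw [gammaScale, hmoment]
  field_simp

theorem integral_sq_gammaScale (ha : 0 < a) (hθ : 0 < θ) :
    ∫ t, t ^ 2 ∂gammaScale a θ = a * (a + 1) * θ ^ 2 := by
  have hmoment := integral_rpow_gammaMeasure (s := 2) ha (inv_pos.2 hθ) (by positivity)
  rw [← one_add_one_eq_two (R := ℝ), ← add_assoc, Real.Gamma_add_one (by positivity),
    Real.Gamma_add_one ha.ne', one_add_one_eq_two] at hmoment
  simp only [Real.rpow_two] at hmoment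
  have := Real.Gamma_pos_of_pos ha
  rw [gammaScale, hmoment]
  field_simp

theorem memLp_id_gammaScale (ha : 0 < a) (hθ : 0 < θ) :
    MemLp (fun t : ℝ => t) 2 (gammaScale a θ) :=
  (memLp_two_iff_integrable_sq (by fun_prop)).2 <| by
    simpa [gammaScale] using integrable_rpow_gammaMeasure (s := 2) ha (inv_pos.2 hθ) (by positivity)

theorem variance_id_gammaScale (ha : 0 < a) (hθ : 0 < θ) :
    variance (fun t : ℝ => t) (gammaScale a θ) = a * θ ^ 2 := by
  have := isProbabilityMeasure_gammaScale ha hθ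
  rw [variance_eq_sub (memLp_id_gammaScale ha hθ), integral_id_gammaScale ha hθ]
  simp only [Pi.pow_apply, integral_sq_gammaScale ha hθ]
  ring

theorem map_const_mul_gammaScale {c : ℝ} (hθ : 0 < θ) (hc : 0 < c) :
    (gammaScale a θ).map (c * ·) = gammaScale a (c * θ) := by
  rw [gammaScale, map_const_mul_gammaMeasure (inv_pos.2 hθ) hc, gammaScale, mul_inv_rev,
    div_eq_mul_inv]

end GammaScale

section Beta

variable {a b : ℝ}

theorem betaPDFReal_of_notMem_Ioo (a b : ℝ) {t : ℝ} (ht : t ∉ Ioo (0 : ℝ) 1) :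
    betaPDFReal a b t = 0 :=
  if_neg ht

theorem betaPDFReal_nonneg (ha : 0 < a) (hb : 0 < b) (t : ℝ) : 0 ≤ betaPDFReal a b t := by
  by_cases ht : t ∈ Ioo (0 : ℝ) 1
  · exact (betaPDFReal_pos ht.1 ht.2 ha hb).le
  · exact (betaPDFReal_of_notMem_Ioo a b ht).ge

theorem betaMeasure_eq_withDensity_indicator (a b : ℝ) :
    betaMeasure a b = volume.withDensity ((Ioo 0 1).indicator (betaPDF a b)) := by
  have hsupport : Function.support (betaPDF a b) ⊆ Ioo 0 1 := fun t ht => by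
    by_contra h
    simp [betaPDF, betaPDFReal_of_notMem_Ioo a b h] at ht
  rw [indicator_eq_self.2 hsupport, betaMeasure]

theorem ae_mem_Ioo_betaMeasure (a b : ℝ) : ∀ᵐ t ∂betaMeasure a b, t ∈ Ioo (0 : ℝ) 1 := by
  rw [betaMeasure_eq_withDensity_indicator, withDensity_indicator measurableSet_Ioo]
  exact (withDensity_absolutelyContinuous _ _).ae_le (ae_restrict_mem measurableSet_Ioo)

theorem integral_betaMeasure {E : Type*} [NormedAddCommGroup E] [NormedSpace ℝ E] (ha : 0 < a)
    (hb : 0 < b) (g : ℝ → E) : ∫ t, g t ∂betaMeasure a b = ∫ t, betaPDFReal a b t • g t :=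
  integral_withDensity_ofReal (measurable_betaPDFReal a b) (betaPDFReal_nonneg ha hb) g

theorem integral_betaPDFReal (ha : 0 < a) (hb : 0 < b) : ∫ t, betaPDFReal a b t = 1 := by
  have := isProbabilityMeasureBeta ha hb
  simpa using (integral_betaMeasure ha hb fun _ => (1 : ℝ)).symm

theorem betaPDFReal_mul_rpow {s : ℝ} (ha : 0 < a) (hb : 0 < b) (has : 0 < a + s) (t : ℝ) :
    betaPDFReal a b t * t ^ s =
      ProbabilityTheory.beta (a + s) b / ProbabilityTheory.beta a b *
        betaPDFReal (a + s) b t := by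
  unfold betaPDFReal
  split_ifs with ht
  · have := beta_pos ha hb
    have := beta_pos has hb
    rw [add_sub_right_comm, Real.rpow_add ht.1]
    field_simp
  · simp

theorem integral_rpow_betaMeasure {s : ℝ} (ha : 0 < a) (hb : 0 < b) (has : 0 < a + s) :
    ∫ t, t ^ s ∂betaMeasure a b =
      ProbabilityTheory.beta (a + s) b / ProbabilityTheory.beta a b := by
  simp only [integral_betaMeasure ha hb, smul_eq_mul, betaPDFReal_mul_rpow ha hb has]
  rw [integral_const_mul, integral_betaPDFReal has hb, mul_one]

theorem Gamma_add_natCast (ha : 0 < a) (n : ℕ) :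
    Real.Gamma (a + n) = (ascPochhammer ℝ n).eval a * Real.Gamma a := by
  induction n with
  | zero => simp
  | succ n ih =>
    rw [Nat.cast_succ, ← add_assoc, Real.Gamma_add_one (by positivity), ih,
      ascPochhammer_succ_eval]
    ring

theorem integral_pow_betaMeasure (ha : 0 < a) (hb : 0 < b) (n : ℕ) :
    ∫ t, t ^ n ∂betaMeasure a b =
      (ascPochhammer ℝ n).eval a / (ascPochhammer ℝ n).eval (a + b) := by
  have hmoment := integral_rpow_betaMeasure (s := n) ha hb (by positivity)
  simp only [Real.rpow_natCast, ProbabilityTheory.beta, add_right_comm a (n : ℝ) b,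
    Gamma_add_natCast ha, Gamma_add_natCast (add_pos ha hb)] at hmoment
  have := Real.Gamma_pos_of_pos ha
  have := Real.Gamma_pos_of_pos hb
  have := Real.Gamma_pos_of_pos (add_pos ha hb)
  have := ascPochhammer_pos n (a + b) (add_pos ha hb)
  rw [hmoment]
  field_simp

end Beta

section GammaBeta

variable {a b r : ℝ}

theorem lintegral_gammaMeasure {f : ℝ → ENNReal} (hf : Measurable f) (a r : ℝ) :
    ∫⁻ u, f u ∂gammaMeasure a r = ∫⁻ u in Ioi 0, gammaPDF a r u * f u := by
  rw [gammaMeasure_eq_withDensity_indicator, withDensity_indicator measurableSet_Ioi,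
    lintegral_withDensity_eq_lintegral_mul _ (measurable_gammaPDF a r) hf]
  simp only [Pi.mul_apply]

theorem map_div_add_gammaMeasure {u : ℝ} (hu : 0 < u) (b r : ℝ) :
    (gammaMeasure b r).map (fun v => u / (u + v)) =
      volume.withDensity ((Ioo 0 1).indicator fun z =>
        ENNReal.ofReal |-(u / z ^ 2)| * gammaPDF b r (u * ((1 - z) / z))) := by
  have hderiv : ∀ z ∈ Ioo (0 : ℝ) 1,
      HasDerivWithinAt (fun z => u * ((1 - z) / z)) (-(u / z ^ 2)) (Ioo 0 1) z := fun z hz => by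
    have h := (((hasDerivAt_id z).const_sub 1).div (hasDerivAt_id z) hz.1.ne').const_mul u
    refine (h.congr_deriv ?_).hasDerivWithinAt
    simp only [id]
    ring
  rw [gammaMeasure_eq_withDensity_indicator]
  refine map_withDensity_indicator_of_invOn _ measurableSet_Ioo measurableSet_Ioi (by fun_prop)
    hderiv ⟨fun z hz => ?_, fun v hv => ?_⟩ (fun z hz => ?_) (fun v hv => ?_)
  · have := hz.1
    field_simp
    ring
  · have : 0 < v := hv
    field_simp
    ring
  · exact mul_pos hu (div_pos (sub_pos.2 hz.2) hz.1)
  · have hv : 0 < v := hv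
    exact ⟨by positivity, (div_lt_one (by positivity)).2 (by linarith)⟩

theorem gammaPDF_mul_gammaPDF {u z : ℝ} (ha : 0 < a) (hb : 0 < b) (hr : 0 < r) (hu : 0 < u)
    (hz : z ∈ Ioo (0 : ℝ) 1) :
    gammaPDF a r u * (ENNReal.ofReal |-(u / z ^ 2)| * gammaPDF b r (u * ((1 - z) / z))) =
      betaPDF a b z * gammaPDF (a + b) (r / z) u := by
  obtain ⟨hz0, hz1⟩ := hz
  have hz1' : 0 < 1 - z := sub_pos.2 hz1
  have hexp : Real.exp (-(r / z * u)) =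
      Real.exp (-(r * u)) * Real.exp (-(r * (u * ((1 - z) / z)))) := by
    rw [← Real.exp_add]
    congr 1
    field_simp
    ring
  have hpow : u ^ (a + b - 1) = u ^ (a - 1) * u ^ (b - 1) * u := by
    rw [← Real.rpow_add hu, ← Real.rpow_add_one hu.ne']
    ring_nf
  have := Real.Gamma_pos_of_pos ha
  have := Real.Gamma_pos_of_pos hb
  have := Real.Gamma_pos_of_pos (add_pos ha hb)
  rw [abs_neg, abs_of_pos (by positivity), gammaPDF_of_nonneg hu.le,
    gammaPDF_of_nonneg (by positivity), gammaPDF_of_nonneg hu.le, betaPDF_of_pos_lt_one hz0 hz1,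
    ← ENNReal.ofReal_mul (by positivity), ← ENNReal.ofReal_mul (by positivity),
    ← ENNReal.ofReal_mul (by unfold ProbabilityTheory.beta; positivity), hexp, hpow,
    ProbabilityTheory.beta, Real.mul_rpow hu.le (by positivity), Real.div_rpow hz1'.le hz0.le,
    Real.div_rpow hr.le hz0.le, Real.rpow_add hr, Real.rpow_add hz0, Real.rpow_sub_one hz0.ne' a,
    Real.rpow_sub_one hz0.ne' b]
  congr 1
  field_simp

theorem map_div_add_prod_gammaMeasure (ha : 0 < a) (hb : 0 < b) (hr : 0 < r) :
    ((gammaMeasure a r).prod (gammaMeasure b r)).map (fun p => p.1 / (p.1 + p.2)) =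
      betaMeasure a b := by
  have := isProbabilityMeasure_gammaMeasure hb hr
  ext A hA
  have hmeas : Measurable fun p : ℝ × ℝ => p.1 / (p.1 + p.2) := by fun_prop
  have hfibre : ∀ u ∈ Ioi (0 : ℝ), gammaPDF a r u *
      gammaMeasure b r (Prod.mk u ⁻¹' ((fun p : ℝ × ℝ => p.1 / (p.1 + p.2)) ⁻¹' A)) =
      ∫⁻ z in Ioo 0 1 ∩ A, gammaPDF a r u *
        (ENNReal.ofReal |-(u / z ^ 2)| * gammaPDF b r (u * ((1 - z) / z))) := fun u hu => by
    rw [lintegral_const_mul' (gammaPDF a r u) _ ENNReal.ofReal_ne_top,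
      ← setLIntegral_indicator measurableSet_Ioo,
      ← withDensity_apply _ hA, ← map_div_add_gammaMeasure hu,
      Measure.map_apply (by fun_prop) hA]
    rfl
  have hmass : ∀ z ∈ Ioo (0 : ℝ) 1 ∩ A, ∫⁻ u in Ioi 0, gammaPDF a r u *
      (ENNReal.ofReal |-(u / z ^ 2)| * gammaPDF b r (u * ((1 - z) / z))) =
      betaPDF a b z := fun z hz => by
    rw [setLIntegral_congr_fun measurableSet_Ioi fun u hu =>
        gammaPDF_mul_gammaPDF ha hb hr hu hz.1,
      lintegral_const_mul _ (measurable_gammaPDF _ _),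
      setLIntegral_Ioi_gammaPDF (add_pos ha hb) (div_pos hr hz.1.1), mul_one]
  rw [Measure.map_apply hmeas hA, Measure.prod_apply (hmeas hA),
    lintegral_gammaMeasure (measurable_measure_prodMk_left (hmeas hA)),
    setLIntegral_congr_fun measurableSet_Ioi hfibre,
    lintegral_lintegral_swap (by fun_prop),
    setLIntegral_congr_fun (measurableSet_Ioo.inter hA) hmass,
    betaMeasure_eq_withDensity_indicator, withDensity_apply _ hA,
    setLIntegral_indicator measurableSet_Ioo]

theorem hasLaw_div_add_of_gammaScale {Ω : Type*} [MeasurableSpace Ω] {P : Measure Ω}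
    [IsProbabilityMeasure P] {U V : Ω → ℝ} {θ : ℝ} (ha : 0 < a) (hb : 0 < b) (hθ : 0 < θ)
    (hU : HasLaw U (gammaScale a θ) P) (hV : HasLaw V (gammaScale b θ) P)
    (hUV : IndepFun U V P) :
    HasLaw (fun ω => U ω / (U ω + V ω)) (betaMeasure a b) P :=
  HasLaw.fun_comp (Y := fun p : ℝ × ℝ => p.1 / (p.1 + p.2))
    ⟨by fun_prop, map_div_add_prod_gammaMeasure ha hb (inv_pos.2 hθ)⟩
    ((indepFun_iff_hasLaw_prodMk_prod hU hV).1 hUV)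

theorem ae_nonneg_of_hasLaw_gammaScale {Ω : Type*} [MeasurableSpace Ω] {P : Measure Ω}
    {U : Ω → ℝ} {θ : ℝ} (hU : HasLaw U (gammaScale a θ) P) : ∀ᵐ ω ∂P, 0 ≤ U ω :=
  (hU.ae_iff (p := fun t => 0 ≤ t) (measurableSet_setOfPred.1 measurableSet_Ici)).2
    (ae_nonneg_gammaMeasure a θ⁻¹)

end GammaBeta

section ScaleOdds

/-- The Möbius map of `(0, 1)` that multiplies the odds `z / (1 - z)` by `γ`. -/
def scaleOdds (γ z : ℝ) : ℝ := γ * z / (1 - (1 - γ) * z)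

variable {γ z : ℝ}

@[fun_prop]
theorem measurable_scaleOdds (γ : ℝ) : Measurable (scaleOdds γ) := by
  unfold scaleOdds
  fun_prop

theorem one_sub_one_sub_mul_pos (hγ : 0 < γ) (hz : z ∈ Icc (0 : ℝ) 1) : 0 < 1 - (1 - γ) * z := by
  rcases hz.2.lt_or_eq with h | rfl
  · nlinarith [mul_nonneg hγ.le hz.1]
  · linarith

theorem one_sub_scaleOdds (hz : 1 - (1 - γ) * z ≠ 0) :
    1 - scaleOdds γ z = (1 - z) / (1 - (1 - γ) * z) := by
  rw [scaleOdds, eq_div_iff hz, sub_mul, div_mul_cancel₀ _ hz]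
  ring

theorem scaleOdds_mem_Ioo_iff (hγ : 0 < γ) : scaleOdds γ z ∈ Ioo 0 1 ↔ z ∈ Ioo 0 1 := by
  refine ⟨fun hx => ?_, fun hz => ?_⟩
  · have hD : 1 - (1 - γ) * z ≠ 0 := fun h => by simp [scaleOdds, h] at hx
    have hx0 : scaleOdds γ z * (1 - (1 - γ) * z) = γ * z := div_mul_cancel₀ _ hD
    have hx1 : (1 - scaleOdds γ z) * (1 - (1 - γ) * z) = 1 - z := by
      rw [one_sub_scaleOdds hD, div_mul_cancel₀ _ hD]
    rcases hD.lt_or_gt with hD | hD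
    · have := mul_neg_of_pos_of_neg hx.1 hD
      have := mul_neg_of_pos_of_neg (sub_pos.2 hx.2) hD
      nlinarith
    · exact ⟨pos_of_mul_pos_right (hx0 ▸ mul_pos hx.1 hD) hγ.le,
        sub_pos.1 (hx1 ▸ mul_pos (sub_pos.2 hx.2) hD)⟩
  · have hD := one_sub_one_sub_mul_pos hγ (Ioo_subset_Icc_self hz)
    refine ⟨div_pos (mul_pos hγ hz.1) hD, sub_pos.1 ?_⟩
    rw [one_sub_scaleOdds hD.ne']
    exact div_pos (sub_pos.2 hz.2) hD

theorem scaleOdds_inv_scaleOdds (hγ : γ ≠ 0) (hz : 1 - (1 - γ) * z ≠ 0) :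
    scaleOdds γ⁻¹ (scaleOdds γ z) = z := by
  rw [mul_comm (1 - γ)] at hz
  have hdenom : 1 - (1 - γ⁻¹) * scaleOdds γ z = (1 - (1 - γ) * z)⁻¹ := by
    rw [scaleOdds]
    field_simp
    ring
  rw [scaleOdds, hdenom, scaleOdds]
  field_simp

theorem hasDerivAt_scaleOdds (hz : 1 - (1 - γ) * z ≠ 0) :
    HasDerivAt (scaleOdds γ) (γ / (1 - (1 - γ) * z) ^ 2) z := by
  have h := ((hasDerivAt_id z).const_mul γ).div
    (((hasDerivAt_id z).const_mul (1 - γ)).const_sub 1) hz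
  refine h.congr_deriv ?_
  simp only [id]
  ring

theorem scaleOdds_div_add {u v : ℝ} (hu : 0 ≤ u) (hv : 0 ≤ v) :
    scaleOdds γ (u / (u + v)) = γ * u / (γ * u + v) := by
  rcases (add_nonneg hu hv).eq_or_lt with h | h
  · obtain ⟨rfl, rfl⟩ := (add_eq_zero_iff_of_nonneg hu hv).1 h.symm
    simp [scaleOdds]
  · have hdenom : 1 - (1 - γ) * (u / (u + v)) = (γ * u + v) / (u + v) := by
      field_simp
      ring
    rw [scaleOdds, hdenom, mul_div_assoc', div_div_div_cancel_right₀ h.ne']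

end ScaleOdds

section GammaRatio

/-- The density of `U / (U + V)` for independent Gamma variables `U`, `V` with shapes `a`, `b`,
where `γ` is the scale of `V` divided by the scale of `U`. It is the density of the image of a
Beta variable under `scaleOdds γ⁻¹`, and `xPDF α γ` is the case `a = 1 / 2`, `b = α`. -/
def gammaRatioPDF (a b γ z : ℝ) : ℝ :=
  γ / (1 - (1 - γ) * z) ^ 2 * betaPDFReal a b (scaleOdds γ z)

variable {a b γ : ℝ}

theorem measurable_gammaRatioPDF (a b γ : ℝ) : Measurable (gammaRatioPDF a b γ) := by
  unfold gammaRatioPDF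
  exact .mul (by fun_prop) ((measurable_betaPDFReal a b).comp (by fun_prop))

theorem gammaRatioPDF_of_notMem_Ioo (a b : ℝ) {z : ℝ} (hγ : 0 < γ) (hz : z ∉ Ioo (0 : ℝ) 1) :
    gammaRatioPDF a b γ z = 0 := by
  rw [gammaRatioPDF, betaPDFReal_of_notMem_Ioo a b (mt (scaleOdds_mem_Ioo_iff hγ).1 hz), mul_zero]

theorem gammaRatioPDF_pos {z : ℝ} (ha : 0 < a) (hb : 0 < b) (hγ : 0 < γ)
    (hz : z ∈ Ioo (0 : ℝ) 1) : 0 < gammaRatioPDF a b γ z := by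
  have hmem := (scaleOdds_mem_Ioo_iff hγ).2 hz
  have hD := one_sub_one_sub_mul_pos hγ (Ioo_subset_Icc_self hz)
  exact mul_pos (by positivity) (betaPDFReal_pos hmem.1 hmem.2 ha hb)

theorem gammaRatioPDF_nonneg (ha : 0 < a) (hb : 0 < b) (hγ : 0 < γ) (z : ℝ) :
    0 ≤ gammaRatioPDF a b γ z := by
  by_cases hz : z ∈ Ioo (0 : ℝ) 1
  · exact (gammaRatioPDF_pos ha hb hγ hz).le
  · exact (gammaRatioPDF_of_notMem_Ioo a b hγ hz).ge

theorem tsupport_gammaRatioPDF (ha : 0 < a) (hb : 0 < b) (hγ : 0 < γ) :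
    tsupport (gammaRatioPDF a b γ) = Icc 0 1 := by
  have hsupport : Function.support (gammaRatioPDF a b γ) = Ioo 0 1 :=
    Subset.antisymm (fun _ hz => by_contra fun h => hz (gammaRatioPDF_of_notMem_Ioo a b hγ h))
      fun _ hz => (gammaRatioPDF_pos ha hb hγ hz).ne'
  rw [tsupport, hsupport, closure_Ioo zero_ne_one]

theorem map_scaleOdds_betaMeasure (a b : ℝ) (hγ : 0 < γ) :
    (betaMeasure a b).map (scaleOdds γ⁻¹) =
      volume.withDensity fun z => ENNReal.ofReal (gammaRatioPDF a b γ z) := by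
  have hdenom {γ : ℝ} (hγ : 0 < γ) {z : ℝ} (hz : z ∈ Ioo (0 : ℝ) 1) : 1 - (1 - γ) * z ≠ 0 :=
    (one_sub_one_sub_mul_pos hγ (Ioo_subset_Icc_self hz)).ne'
  have hpdf : ((Ioo 0 1).indicator fun z =>
      ENNReal.ofReal |γ / (1 - (1 - γ) * z) ^ 2| * betaPDF a b (scaleOdds γ z)) =
      fun z => ENNReal.ofReal (gammaRatioPDF a b γ z) := by
    ext z
    by_cases hz : z ∈ Ioo (0 : ℝ) 1
    · rw [indicator_of_mem hz, abs_of_nonneg (by positivity), betaPDF,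
        ← ENNReal.ofReal_mul (by positivity), gammaRatioPDF]
    · rw [indicator_of_notMem hz, gammaRatioPDF_of_notMem_Ioo a b hγ hz, ENNReal.ofReal_zero]
  rw [betaMeasure_eq_withDensity_indicator, ← hpdf]
  exact map_withDensity_indicator_of_invOn _ measurableSet_Ioo measurableSet_Ioo (by fun_prop)
    (fun z hz => (hasDerivAt_scaleOdds (hdenom hγ hz)).hasDerivWithinAt)
    ⟨fun z hz => scaleOdds_inv_scaleOdds hγ.ne' (hdenom hγ hz), fun z hz => by
      simpa using scaleOdds_inv_scaleOdds (inv_pos.2 hγ).ne' (hdenom (inv_pos.2 hγ) hz)⟩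
    (fun z => (scaleOdds_mem_Ioo_iff hγ).2) (fun z => (scaleOdds_mem_Ioo_iff (inv_pos.2 hγ)).2)

theorem hasLaw_div_add {Ω : Type*} [MeasurableSpace Ω] {P : Measure Ω} [IsProbabilityMeasure P]
    {U V : Ω → ℝ} {θ : ℝ} (ha : 0 < a) (hb : 0 < b) (hγ : 0 < γ) (hθ : 0 < θ)
    (hU : HasLaw U (gammaScale a θ) P) (hV : HasLaw V (gammaScale b (θ * γ)) P)
    (hUV : IndepFun U V P) :
    HasLaw (fun ω => U ω / (U ω + V ω))
      (volume.withDensity fun z => ENNReal.ofReal (gammaRatioPDF a b γ z)) P := by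
  have hγU : HasLaw (fun ω => γ * U ω) (gammaScale a (θ * γ)) P :=
    HasLaw.fun_comp (Y := (γ * ·))
      ⟨by fun_prop, by rw [map_const_mul_gammaScale hθ hγ, mul_comm γ θ]⟩ hU
  have hbeta : HasLaw (fun ω => γ * U ω / (γ * U ω + V ω)) (betaMeasure a b) P :=
    hasLaw_div_add_of_gammaScale ha hb (mul_pos hθ hγ) hγU hV
      (hUV.comp (measurable_const_mul γ) measurable_id)
  refine (HasLaw.fun_comp ⟨by fun_prop, map_scaleOdds_betaMeasure a b hγ⟩ hbeta).congr ?_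
  filter_upwards [ae_nonneg_of_hasLaw_gammaScale hU, ae_nonneg_of_hasLaw_gammaScale hV]
    with ω hU0 hV0
  rw [scaleOdds_div_add (mul_nonneg hγ.le hU0) hV0, inv_mul_cancel_left₀ hγ.ne']

theorem integrable_div_add {Ω : Type*} [MeasurableSpace Ω] {P : Measure Ω} [IsFiniteMeasure P]
    {U V : Ω → ℝ} (hU : AEMeasurable U P) (hV : AEMeasurable V P) (hU0 : ∀ᵐ ω ∂P, 0 ≤ U ω)
    (hV0 : ∀ᵐ ω ∂P, 0 ≤ V ω) : Integrable (fun ω => U ω / (U ω + V ω)) P := by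
  refine .of_bound (hU.div (hU.add hV)).aestronglyMeasurable 1 ?_
  filter_upwards [hU0, hV0] with ω hU0 hV0
  rw [Real.norm_of_nonneg (by positivity)]
  exact div_le_one_of_le₀ (by linarith) (by positivity)

theorem gammaRatioPDF_eq_mul_betaPDFReal (a b : ℝ) (hγ : 0 < γ) (z : ℝ) :
    gammaRatioPDF a b γ z =
      γ ^ a * (betaPDFReal a b z * (1 - (1 - γ) * z) ^ (-(a + b))) := by
  by_cases hz : z ∈ Ioo (0 : ℝ) 1
  · have hD := one_sub_one_sub_mul_pos hγ (Ioo_subset_Icc_self hz)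
    have hz1 : 0 < 1 - z := sub_pos.2 hz.2
    rw [gammaRatioPDF, betaPDFReal, if_pos (mem_Ioo.1 ((scaleOdds_mem_Ioo_iff hγ).2 hz)),
      one_sub_scaleOdds hD.ne', scaleOdds, betaPDFReal, if_pos (mem_Ioo.1 hz),
      Real.div_rpow (mul_pos hγ hz.1).le hD.le, Real.mul_rpow hγ.le hz.1.le,
      Real.div_rpow hz1.le hD.le, Real.rpow_neg hD.le, Real.rpow_add hD,
      Real.rpow_sub_one hγ.ne', Real.rpow_sub_one hD.ne' a, Real.rpow_sub_one hD.ne' b]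
    field_simp
  · rw [gammaRatioPDF_of_notMem_Ioo a b hγ hz, betaPDFReal_of_notMem_Ioo a b hz, zero_mul,
      mul_zero]

theorem intervalIntegral_mul_gammaRatioPDF (a b : ℝ) (hγ : 0 < γ) (g : ℝ → ℝ) :
    ∫ z in (0 : ℝ)..1, g z * gammaRatioPDF a b γ z = ∫ z, gammaRatioPDF a b γ z * g z := by
  rw [intervalIntegral.integral_of_le zero_le_one, integral_Ioc_eq_integral_Ioo,
    setIntegral_eq_integral_of_forall_compl_eq_zero fun z hz => by
      rw [gammaRatioPDF_of_notMem_Ioo a b hγ hz, mul_zero]]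
  simp only [mul_comm]

theorem integrable_gammaRatioPDF (ha : 0 < a) (hb : 0 < b) (hγ : 0 < γ) :
    Integrable (gammaRatioPDF a b γ) := by
  have := isProbabilityMeasureBeta ha hb
  have hfinite : IsFiniteMeasure
      (volume.withDensity fun z => ENNReal.ofReal (gammaRatioPDF a b γ z)) := by
    rw [← map_scaleOdds_betaMeasure a b hγ]
    infer_instance
  simpa using (integrable_withDensity_ofReal_iff (measurable_gammaRatioPDF a b γ)
    (gammaRatioPDF_nonneg ha hb hγ)).1 (integrable_const (1 : ℝ))

theorem intervalIntegrable_mul_gammaRatioPDF (ha : 0 < a) (hb : 0 < b) (hγ : 0 < γ) :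
    IntervalIntegrable (fun z => z * gammaRatioPDF a b γ z) volume 0 1 :=
  (integrable_gammaRatioPDF ha hb hγ).intervalIntegrable.continuousOn_mul continuousOn_id

theorem integral_div_add {Ω : Type*} [MeasurableSpace Ω] {P : Measure Ω} [IsProbabilityMeasure P]
    {U V : Ω → ℝ} {θ : ℝ} (ha : 0 < a) (hb : 0 < b) (hγ : 0 < γ) (hθ : 0 < θ)
    (hU : HasLaw U (gammaScale a θ) P) (hV : HasLaw V (gammaScale b (θ * γ)) P)
    (hUV : IndepFun U V P) :
    ∫ ω, U ω / (U ω + V ω) ∂P = ∫ z in (0 : ℝ)..1, z * gammaRatioPDF a b γ z := by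
  rw [(hasLaw_div_add ha hb hγ hθ hU hV hUV).integral_eq,
    integral_withDensity_ofReal (measurable_gammaRatioPDF a b γ) (gammaRatioPDF_nonneg ha hb hγ),
    intervalIntegral_mul_gammaRatioPDF a b hγ]
  simp only [smul_eq_mul]

end GammaRatio

section EulerTransform

theorem isOpen_cutPlane : IsOpen cutPlane :=
  Complex.isOpen_slitPlane.preimage (by fun_prop)

theorem one_sub_mul_mem_slitPlane {z : ℂ} (hz : z ∈ cutPlane) {t : ℝ} (ht : t ∈ Icc (0 : ℝ) 1) :
    1 - z * t ∈ Complex.slitPlane := by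
  have hsegment : 1 - z * t = (1 - t) • (1 : ℂ) + t • (1 - z) := by
    simp only [Complex.real_smul]
    push_cast
    ring
  rw [hsegment]
  exact Complex.starConvex_one_slitPlane hz (sub_nonneg.2 ht.2) ht.1 (by ring)

theorem exists_nhds_norm_one_sub_mul_cpow_le (a : ℂ) {z₀ : ℂ} (hz₀ : z₀ ∈ cutPlane) :
    ∃ U ∈ nhds z₀, U ⊆ cutPlane ∧
      ∃ C, ∀ z ∈ U, ∀ t ∈ Icc (0 : ℝ) 1, ‖(1 - z * t) ^ a‖ ≤ C := by
  obtain ⟨r, hr, hball⟩ := Metric.nhds_basis_closedBall.mem_iff.1 (isOpen_cutPlane.mem_nhds hz₀)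
  have hcont : ContinuousOn (fun p : ℂ × ℝ => (1 - p.1 * p.2) ^ a)
      (Metric.closedBall z₀ r ×ˢ Icc (0 : ℝ) 1) :=
    ContinuousOn.cpow_const (by fun_prop) fun p hp =>
      one_sub_mul_mem_slitPlane (hball hp.1) hp.2
  obtain ⟨C, hC⟩ :=
    ((isCompact_closedBall z₀ r).prod isCompact_Icc).exists_bound_of_continuousOn hcont
  exact ⟨_, Metric.closedBall_mem_nhds z₀ hr, hball, C, fun z hz t ht => hC (z, t) ⟨hz, ht⟩⟩

/-- The Euler transform `z ↦ ∫ (1 - z t)^(-a) dμ(t)` of a measure on `[0, 1]`. For a Beta law `μ`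
it is Euler's integral representation of Gauss's hypergeometric function. -/
def eulerTransform (μ : Measure ℝ) (a z : ℂ) : ℂ := ∫ t : ℝ, (1 - z * t) ^ (-a) ∂μ

variable {μ : Measure ℝ} [IsFiniteMeasure μ]

theorem integrable_one_sub_mul_cpow (hμ : ∀ᵐ t ∂μ, t ∈ Icc (0 : ℝ) 1) (a : ℂ) {z : ℂ}
    (hz : z ∈ cutPlane) : Integrable (fun t : ℝ => (1 - z * t) ^ a) μ := by
  obtain ⟨U, hU, -, C, hC⟩ := exists_nhds_norm_one_sub_mul_cpow_le a hz
  exact .of_bound (Measurable.aestronglyMeasurable (by fun_prop)) C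
    (hμ.mono (hC z (mem_of_mem_nhds hU)))

theorem differentiableOn_eulerTransform (hμ : ∀ᵐ t ∂μ, t ∈ Icc (0 : ℝ) 1) (a : ℂ) :
    DifferentiableOn ℂ (eulerTransform μ a) cutPlane := by
  intro z₀ hz₀
  obtain ⟨U, hU, hUcut, C, hC⟩ := exists_nhds_norm_one_sub_mul_cpow_le (-a - 1) hz₀
  have hderiv (z : ℂ) (hz : z ∈ cutPlane) (t : ℝ) (ht : t ∈ Icc (0 : ℝ) 1) :
      HasDerivAt (fun z : ℂ => (1 - z * t) ^ (-a)) (-a * (1 - z * t) ^ (-a - 1) * -t) z := by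
    have hlinear : HasDerivAt (fun z : ℂ => 1 - z * t) (-t) z := by
      simpa using ((hasDerivAt_id z).mul_const (t : ℂ)).const_sub 1
    exact hlinear.cpow_const (one_sub_mul_mem_slitPlane hz ht)
  have hbound (z : ℂ) (hz : z ∈ U) (t : ℝ) (ht : t ∈ Icc (0 : ℝ) 1) :
      ‖-a * (1 - z * t) ^ (-a - 1) * -t‖ ≤ ‖a‖ * C := by
    have ht1 : ‖(-t : ℂ)‖ ≤ 1 := by
      rw [norm_neg, Complex.norm_real, Real.norm_of_nonneg ht.1]
      exact ht.2
    rw [norm_mul, norm_mul, norm_neg]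
    have hC0 := mul_le_mul_of_nonneg_left (hC z hz t ht) (norm_nonneg a)
    exact (mul_le_of_le_one_right (by positivity) ht1).trans hC0
  exact (hasDerivAt_integral_of_dominated_loc_of_deriv_le (𝕜 := ℂ)
    (F := fun z (t : ℝ) => (1 - z * t) ^ (-a))
    (F' := fun z (t : ℝ) => -a * (1 - z * t) ^ (-a - 1) * -t) (bound := fun _ => ‖a‖ * C) hU
    (.of_forall fun z => Measurable.aestronglyMeasurable (by fun_prop))
    (integrable_one_sub_mul_cpow hμ (-a) hz₀) (Measurable.aestronglyMeasurable (by fun_prop))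
    (hμ.mono fun t ht z hz => hbound z hz t ht) (integrable_const _)
    (hμ.mono fun t ht z hz => hderiv z (hUcut hz) t ht)).2.differentiableAt.differentiableWithinAt

theorem hasSum_one_sub_cpow (a : ℂ) {z : ℂ} (hz : ‖z‖ < 1) :
    HasSum (fun n : ℕ => (n.factorial : ℂ)⁻¹ * (ascPochhammer ℂ n).eval a * z ^ n)
      ((1 - z) ^ (-a)) := by
  have h := (Complex.one_div_one_sub_cpow_hasFPowerSeriesOnBall_zero a).hasSum
    (y := z) (by simpa [Metric.mem_eball, edist_zero_right, ← ofReal_norm] using hz)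
  simp only [zero_add, FormalMultilinearSeries.ofScalars_apply_eq, smul_eq_mul] at h
  rw [Complex.cpow_neg, ← one_div]
  refine h.congr_fun fun n => ?_
  congr 1
  rw [← Ring.multichoose_eq, inv_mul_eq_iff_eq_mul₀ (by exact_mod_cast n.factorial_ne_zero),
    ← nsmul_eq_mul, Ring.factorial_nsmul_multichoose_eq_ascPochhammer,
    Polynomial.ascPochhammer_smeval_eq_eval]

theorem hasSum_eulerTransform (hμ : ∀ᵐ t ∂μ, t ∈ Icc (0 : ℝ) 1) (a : ℂ) {z : ℂ} (hz : ‖z‖ < 1) :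
    HasSum (fun n : ℕ => (n.factorial : ℂ)⁻¹ * (ascPochhammer ℂ n).eval a * z ^ n *
      ((∫ t, t ^ n ∂μ : ℝ) : ℂ)) (eulerTransform μ a z) := by
  set c : ℕ → ℂ := fun n => (n.factorial : ℂ)⁻¹ * (ascPochhammer ℂ n).eval a * z ^ n
  have hle (n : ℕ) : ∀ᵐ t ∂μ, ‖c n * ((t ^ n : ℝ) : ℂ)‖ ≤ ‖c n‖ := hμ.mono fun t ht => by
    rw [norm_mul, Complex.norm_real, Real.norm_of_nonneg (pow_nonneg ht.1 n)]
    exact mul_le_of_le_one_right (norm_nonneg _) (pow_le_one₀ ht.1 ht.2)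
  have hint (n : ℕ) : Integrable (fun t : ℝ => c n * ((t ^ n : ℝ) : ℂ)) μ :=
    .of_bound (by fun_prop) _ (hle n)
  have hsummable : Summable fun n => ∫ t : ℝ, ‖c n * ((t ^ n : ℝ) : ℂ)‖ ∂μ := by
    refine .of_nonneg_of_le (fun n => integral_nonneg fun _ => norm_nonneg _)
      (fun n => integral_mono_ae (hint n).norm (integrable_const _) (hle n)) ?_
    simpa [c] using (hasSum_one_sub_cpow a hz).summable.norm.mul_left (μ.real univ)
  have hseries : ∀ᵐ t ∂μ, ∑' n, c n * ((t ^ n : ℝ) : ℂ) = (1 - z * t) ^ (-a) :=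
    hμ.mono fun t ht => by
      have hzt : ‖z * t‖ < 1 := by
        rw [norm_mul, Complex.norm_real, Real.norm_of_nonneg ht.1]
        exact (mul_le_of_le_one_right (norm_nonneg _) ht.2).trans_lt hz
      rw [← (hasSum_one_sub_cpow a hzt).tsum_eq]
      simp only [c, mul_pow, Complex.ofReal_pow, mul_assoc]
  rw [eulerTransform, ← integral_congr_ae hseries]
  simpa only [integral_const_mul, integral_complex_ofReal] using
    hasSum_integral_of_summable_integral_norm hint hsummable

end EulerTransform

section Hypergeometric

variable {b β : ℝ}

theorem isGaussHypergeometric_eulerTransform (a : ℂ) (hb : 0 < b) (hβ : 0 < β) :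
    IsGaussHypergeometric a b (b + β) (eulerTransform (betaMeasure b β) a) := by
  have := isProbabilityMeasureBeta hb hβ
  have hunit : ∀ᵐ t ∂betaMeasure b β, t ∈ Icc (0 : ℝ) 1 :=
    (ae_mem_Ioo_betaMeasure b β).mono fun t ht => Ioo_subset_Icc_self ht
  have hcast (n : ℕ) (x : ℝ) :
      (((ascPochhammer ℝ n).eval x : ℝ) : ℂ) = (ascPochhammer ℂ n).eval (x : ℂ) := by
    rw [← Complex.ofRealHom_eq_coe, ← Polynomial.eval₂_at_apply,
      ← ascPochhammer_eval₂ Complex.ofRealHom n, Complex.ofRealHom_eq_coe]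
  refine ⟨differentiableOn_eulerTransform hunit a, fun z hz => ?_⟩
  rw [← (hasSum_eulerTransform hunit a hz).tsum_eq, ordinaryHypergeometric_eq_tsum]
  refine tsum_congr fun n => ?_
  rw [integral_pow_betaMeasure hb hβ, Complex.ofReal_div, hcast, hcast, Complex.ofReal_add,
    smul_eq_mul]
  ring

theorem hyp2F1_comm (a b c : ℂ) : hyp2F1 a b c = hyp2F1 b a c := by
  have hseries (z : ℂ) : ₂F₁ a b c z = ₂F₁ b a c z := by
    rw [ordinaryHypergeometric, ordinaryHypergeometricSeries_symm, ordinaryHypergeometric]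
  have hiff : IsGaussHypergeometric a b c = IsGaussHypergeometric b a c := by
    ext F
    exact ⟨fun h => ⟨h.1, fun z hz => (h.2 z hz).trans (hseries z)⟩,
      fun h => ⟨h.1, fun z hz => (h.2 z hz).trans (hseries z).symm⟩⟩
  unfold hyp2F1
  rw [hiff]

theorem hyp2F1_ofReal {x : ℝ} (a : ℝ) (hb : 0 < b) (hβ : 0 < β) (hx : x < 1) :
    hyp2F1 a b (b + β) x = ((∫ t, (1 - x * t) ^ (-a) ∂betaMeasure b β : ℝ) : ℂ) := by
  have hcut : (x : ℂ) ∈ cutPlane := .inl (by simpa using hx)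
  rw [(isGaussHypergeometric_eulerTransform a hb hβ).eqOn hcut, eulerTransform,
    ← integral_complex_ofReal]
  refine integral_congr_ae ((ae_mem_Ioo_betaMeasure b β).mono fun t ht => ?_)
  have hnonneg : 0 ≤ 1 - x * t := by nlinarith [ht.1, ht.2]
  simp only [Complex.ofReal_cpow hnonneg]
  push_cast
  rfl

theorem integral_rpow_mul_gammaRatioPDF {a γ s : ℝ} (ha : 0 < a) (hb : 0 < b) (hγ : 0 < γ)
    (has : 0 < a + s) :
    ((∫ z in (0 : ℝ)..1, z ^ s * gammaRatioPDF a b γ z : ℝ) : ℂ) =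
      ((γ ^ a * (ProbabilityTheory.beta (a + s) b / ProbabilityTheory.beta a b) : ℝ) : ℂ) *
        hyp2F1 (a + b) (a + s) (a + s + b) (1 - γ) := by
  have hpdf (z : ℝ) : gammaRatioPDF a b γ z * z ^ s =
      γ ^ a * (ProbabilityTheory.beta (a + s) b / ProbabilityTheory.beta a b) *
        (betaPDFReal (a + s) b z * (1 - (1 - γ) * z) ^ (-(a + b))) := by
    linear_combination z ^ s * gammaRatioPDF_eq_mul_betaPDFReal a b hγ z +
      γ ^ a * (1 - (1 - γ) * z) ^ (-(a + b)) * betaPDFReal_mul_rpow ha hb has z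
  have heuler := hyp2F1_ofReal (a + b) has hb (sub_lt_self 1 hγ)
  push_cast at heuler
  rw [intervalIntegral_mul_gammaRatioPDF a b hγ, heuler, ← Complex.ofReal_mul,
    integral_betaMeasure has hb, ← integral_const_mul]
  simp only [hpdf, smul_eq_mul]

theorem beta_add_one_div_beta (a b : ℝ) (ha : 0 < a) (hb : 0 < b) :
    ProbabilityTheory.beta (a + 1) b / ProbabilityTheory.beta a b =
      Real.Gamma (a + 1) * Real.Gamma (a + b) / (Real.Gamma a * Real.Gamma (a + 1 + b)) := by
  have := Real.Gamma_pos_of_pos ha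
  have := Real.Gamma_pos_of_pos hb
  have := Real.Gamma_pos_of_pos (add_pos ha hb)
  have := Real.Gamma_pos_of_pos (show 0 < a + 1 + b by positivity)
  rw [ProbabilityTheory.beta, ProbabilityTheory.beta]
  field_simp

theorem integral_mul_xPDF {α γ : ℝ} (hα : 0 < α) (hγ : 0 < γ) :
    ((∫ z in (0 : ℝ)..1, z * xPDF α γ z : ℝ) : ℂ) =
      ((γ ^ (1 / 2 : ℝ) * (Real.Gamma (3 / 2) * Real.Gamma (1 / 2 + α) /
          (Real.Gamma (1 / 2) * Real.Gamma (3 / 2 + α))) : ℝ) : ℂ) *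
        hyp2F1 (3 / 2) (1 / 2 + α) (3 / 2 + α) (1 - γ) := by
  have hmean := integral_rpow_mul_gammaRatioPDF (a := 1 / 2) (s := 1) one_half_pos hα hγ
    (by positivity)
  rw [beta_add_one_div_beta _ _ one_half_pos hα, hyp2F1_comm] at hmean
  have hthree : (1 / 2 : ℝ) + 1 = 3 / 2 := by norm_num
  have hthree' : (1 / 2 : ℂ) + 1 = 3 / 2 := by norm_num
  push_cast at hmean ⊢
  simp only [hthree, hthree', Real.rpow_one] at hmean
  exact hmean

end Hypergeometric


section ChiSquare

variable {d : ℕ}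

instance : IsProbabilityMeasure (stdNormal d) := by
  unfold stdNormal
  infer_instance

@[fun_prop]
theorem measurable_uVar (i : Fin d) : Measurable (uVar i) := by
  unfold uVar
  fun_prop

theorem hasLaw_uVar (i : Fin d) : HasLaw (uVar i) (gammaScale (1 / 2) 2) (stdNormal d) :=
  HasLaw.fun_comp (Y := fun x : ℝ => x ^ 2) ⟨by fun_prop, map_sq_gaussianReal⟩
    (measurePreserving_eval (fun _ : Fin d => gaussianReal 0 1) i).hasLaw

theorem iIndepFun_uVar : iIndepFun (uVar (d := d)) (stdNormal d) :=
  iIndepFun_pi (μ := fun _ : Fin d => gaussianReal 0 1) (X := fun _ x => x ^ 2) fun _ => by fun_prop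

theorem memLp_uVar (i : Fin d) : MemLp (uVar i) 2 (stdNormal d) :=
  (memLp_id_gammaScale one_half_pos two_pos).comp_measurePreserving
    ((hasLaw_uVar i).measurePreserving (measurable_uVar i))

theorem integral_uVar (i : Fin d) : ∫ y, uVar i y ∂stdNormal d = 1 := by
  rw [(hasLaw_uVar i).integral_eq, integral_id_gammaScale one_half_pos two_pos]
  norm_num

theorem variance_uVar (i : Fin d) : variance (uVar i) (stdNormal d) = 2 := by
  refine ((hasLaw_uVar i).variance_eq.trans (variance_id_gammaScale one_half_pos two_pos)).trans ?_
  norm_num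

variable (s : Finset (Fin d)) (w : Fin d → ℝ)

theorem memLp_sum_smul_uVar : MemLp (∑ l ∈ s, w l • uVar l) 2 (stdNormal d) :=
  memLp_finsetSum' _ fun l _ => (memLp_uVar l).const_smul _

theorem integral_sum_smul_uVar :
    ∫ y, (∑ l ∈ s, w l • uVar l) y ∂stdNormal d = ∑ l ∈ s, w l := by
  simp only [Finset.sum_apply, Pi.smul_apply, smul_eq_mul]
  rw [integral_finsetSum _ fun l _ => ((memLp_uVar l).integrable one_le_two).const_mul _]
  simp only [integral_const_mul, integral_uVar, mul_one]

theorem variance_sum_smul_uVar :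
    variance (∑ l ∈ s, w l • uVar l) (stdNormal d) = 2 * ∑ l ∈ s, w l ^ 2 := by
  rw [IndepFun.variance_sum fun l _ => (memLp_uVar l).const_smul _]
  · simp only [variance_smul, variance_uVar, Finset.mul_sum, mul_comm]
  · intro l _ m _ hlm
    exact (iIndepFun_uVar.indepFun hlm).comp (φ := fun x => w l * x) (ψ := fun x => w m * x)
      (by fun_prop) (by fun_prop)

variable {s} in
theorem indepFun_uVar_sum_smul_uVar {i : Fin d} (hi : i ∉ s) :
    IndepFun (uVar i) (∑ l ∈ s, w l • uVar l) (stdNormal d) := by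
  have hpair := iIndepFun_uVar.indepFun_finset {i} s (Finset.disjoint_singleton_left.2 hi)
    measurable_uVar
  have hmeas : Measurable fun f : s → ℝ => ∑ l : s, w l * f l := by fun_prop
  have hsum : ∑ l ∈ s, w l • uVar l = fun y => ∑ l : s, w l * uVar l y := by
    ext y
    simp only [Finset.sum_apply, Pi.smul_apply, smul_eq_mul]
    exact (Finset.sum_coe_sort s fun l => w l * uVar l y).symm
  rw [hsum]
  exact hpair.comp (measurable_pi_apply ⟨i, Finset.mem_singleton_self i⟩) hmeas

end ChiSquare

section Surrogate

variable {d : ℕ} {σ : Fin d → ℝ} {k : ℕ} {i : Fin d}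

theorem beta_nonneg (σ : Fin d → ℝ) (k : ℕ) (l : Fin d) : 0 ≤ beta σ k l := sq_nonneg _

theorem sum_beta_sq_pos (hβ : 0 < ∑ l ∈ Finset.univ.erase i, beta σ k l) :
    0 < ∑ l ∈ Finset.univ.erase i, beta σ k l ^ 2 := by
  obtain ⟨l, hl, hne⟩ := Finset.exists_ne_zero_of_sum_ne_zero hβ.ne'
  exact Finset.sum_pos' (fun l _ => sq_nonneg _) ⟨l, hl, by positivity⟩

theorem alpha_pos (hβ : 0 < ∑ l ∈ Finset.univ.erase i, beta σ k l) : 0 < alpha σ k i := by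
  have := sum_beta_sq_pos hβ
  unfold alpha
  positivity

theorem gam_pos (hβi : 0 < beta σ k i) (hβ : 0 < ∑ l ∈ Finset.univ.erase i, beta σ k l) :
    0 < gam σ k i := by
  have := sum_beta_sq_pos hβ
  unfold gam
  positivity

theorem alpha_mul_two_mul_gam (hβ : 0 < ∑ l ∈ Finset.univ.erase i, beta σ k l) :
    alpha σ k i * (2 * gam σ k i) = ∑ l ∈ Finset.univ.erase i, beta σ k l / beta σ k i := by
  have := sum_beta_sq_pos hβ
  rw [← Finset.sum_div, alpha, gam]
  field_simp

theorem alpha_mul_two_mul_gam_sq (hβ : 0 < ∑ l ∈ Finset.univ.erase i, beta σ k l) :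
    alpha σ k i * (2 * gam σ k i) ^ 2 =
      2 * ∑ l ∈ Finset.univ.erase i, (beta σ k l / beta σ k i) ^ 2 := by
  have := sum_beta_sq_pos hβ
  simp only [div_pow]
  rw [← Finset.sum_div, alpha, gam]
  field_simp

theorem vVar_eq_sum_smul_uVar (σ : Fin d → ℝ) (k : ℕ) (i : Fin d) :
    vVar σ k i = ∑ l ∈ Finset.univ.erase i, (beta σ k l / beta σ k i) • uVar l := by
  ext y
  simp only [vVar, uVar, Finset.sum_apply, Pi.smul_apply, smul_eq_mul]

theorem measurable_vVar (σ : Fin d → ℝ) (k : ℕ) (i : Fin d) : Measurable (vVar σ k i) := by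
  unfold vVar
  fun_prop

theorem vVar_nonneg (σ : Fin d → ℝ) (k : ℕ) (i : Fin d) (y : Fin d → ℝ) : 0 ≤ vVar σ k i y :=
  Finset.sum_nonneg fun l _ =>
    mul_nonneg (div_nonneg (beta_nonneg σ k l) (beta_nonneg σ k i)) (sq_nonneg _)

theorem indepFun_uVar_vVar (σ : Fin d → ℝ) (k : ℕ) (i : Fin d) :
    IndepFun (uVar i) (vVar σ k i) (stdNormal d) := by
  rw [vVar_eq_sum_smul_uVar]
  exact indepFun_uVar_sum_smul_uVar _ (Finset.notMem_erase i _)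

theorem memLp_vVar (σ : Fin d → ℝ) (k : ℕ) (i : Fin d) :
    MemLp (vVar σ k i) 2 (stdNormal d) := by
  rw [vVar_eq_sum_smul_uVar]
  exact memLp_sum_smul_uVar _ _

theorem integral_vVar_eq_integral_gammaScale (hβi : 0 < beta σ k i)
    (hβ : 0 < ∑ l ∈ Finset.univ.erase i, beta σ k l) :
    ∫ y, vVar σ k i y ∂stdNormal d = ∫ t, t ∂gammaScale (alpha σ k i) (2 * gam σ k i) := by
  rw [integral_id_gammaScale (alpha_pos hβ) (mul_pos two_pos (gam_pos hβi hβ)),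
    alpha_mul_two_mul_gam hβ, vVar_eq_sum_smul_uVar, integral_sum_smul_uVar]

theorem variance_vVar_eq_variance_gammaScale (hβi : 0 < beta σ k i)
    (hβ : 0 < ∑ l ∈ Finset.univ.erase i, beta σ k l) :
    variance (vVar σ k i) (stdNormal d) =
      variance (fun t => t) (gammaScale (alpha σ k i) (2 * gam σ k i)) := by
  rw [variance_id_gammaScale (alpha_pos hβ) (mul_pos two_pos (gam_pos hβi hβ)),
    alpha_mul_two_mul_gam_sq hβ, vVar_eq_sum_smul_uVar, variance_sum_smul_uVar]

theorem lam_eq_integral_beta (σ : Fin d → ℝ) (k : ℕ) (i : Fin d) :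
    lam σ k i = ∫ y, beta σ k i * y i ^ 2 / (beta σ k i * y i ^ 2 +
      ∑ l ∈ Finset.univ.erase i, beta σ k l * y l ^ 2) ∂stdNormal d := by
  unfold lam
  congr 1 with y
  rw [Finset.add_sum_erase _ (fun l => beta σ k l * y l ^ 2) (Finset.mem_univ i)]
  simp only [beta, mul_pow, mul_comm]

theorem lam_eq_integral_div_add (hβi : 0 < beta σ k i) :
    lam σ k i = ∫ y, uVar i y / (uVar i y + vVar σ k i y) ∂stdNormal d := by
  rw [lam_eq_integral_beta]
  congr 1 with y
  have hvVar : ∑ l ∈ Finset.univ.erase i, beta σ k l * y l ^ 2 = beta σ k i * vVar σ k i y := by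
    rw [vVar, Finset.mul_sum]
    refine Finset.sum_congr rfl fun l _ => ?_
    field_simp
  rw [hvVar, ← mul_add, mul_div_mul_left _ _ hβi.ne', uVar]

theorem integrable_uVar_div_add_vVar (σ : Fin d → ℝ) (k : ℕ) (i : Fin d) :
    Integrable (fun y => uVar i y / (uVar i y + vVar σ k i y)) (stdNormal d) :=
  integrable_div_add (measurable_uVar i).aemeasurable (measurable_vVar σ k i).aemeasurable
    (ae_of_all _ fun y => sq_nonneg (y i)) (ae_of_all _ (vVar_nonneg σ k i))

end Surrogate

end SpectralAug

end

theorem proposition2 {d : ℕ} (σ : Fin d → ℝ) (k : ℕ) (i : Fin d)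
    (hβi : 0 < SpectralAug.beta σ k i)
    (hβ : 0 < ∑ l ∈ Finset.univ.erase i, SpectralAug.beta σ k l) :
    -- the parameters are admissible
    0 < SpectralAug.alpha σ k i ∧ 0 < SpectralAug.gam σ k i ∧
    -- the expected value is that of `u / (u + vᵢ)`, exactly
    SpectralAug.lam σ k i =
      ∫ y, SpectralAug.beta σ k i * y i ^ 2 / (SpectralAug.beta σ k i * y i ^ 2 +
        ∑ l ∈ Finset.univ.erase i, SpectralAug.beta σ k l * y l ^ 2) ∂SpectralAug.stdNormal d ∧
    SpectralAug.lam σ k i =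
      ∫ y, SpectralAug.uVar i y / (SpectralAug.uVar i y + SpectralAug.vVar σ k i y)
        ∂SpectralAug.stdNormal d ∧
    Integrable (fun y => SpectralAug.uVar i y /
      (SpectralAug.uVar i y + SpectralAug.vVar σ k i y)) (SpectralAug.stdNormal d) ∧
    -- `u` has law `Gamma(1/2, 2)` and is independent of `vᵢ`
    HasLaw (SpectralAug.uVar i) (SpectralAug.gammaScale (1 / 2) 2) (SpectralAug.stdNormal d) ∧
    IndepFun (SpectralAug.uVar i) (SpectralAug.vVar σ k i) (SpectralAug.stdNormal d) ∧
    -- `Gamma(αᵢ, 2γᵢ)` has the same mean and variance as `vᵢ`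
    MemLp (SpectralAug.vVar σ k i) 2 (SpectralAug.stdNormal d) ∧
    MemLp (fun t : ℝ => t) 2
      (SpectralAug.gammaScale (SpectralAug.alpha σ k i) (2 * SpectralAug.gam σ k i)) ∧
    ∫ y, SpectralAug.vVar σ k i y ∂SpectralAug.stdNormal d =
      ∫ t, t ∂SpectralAug.gammaScale (SpectralAug.alpha σ k i) (2 * SpectralAug.gam σ k i) ∧
    variance (SpectralAug.vVar σ k i) (SpectralAug.stdNormal d) =
      variance (fun t : ℝ => t)
        (SpectralAug.gammaScale (SpectralAug.alpha σ k i) (2 * SpectralAug.gam σ k i)) ∧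
    -- with `vᵢ` replaced by a `Gamma(αᵢ, 2γᵢ)` variable: density and expectation of `u / (u + vᵢ)`
    (∀ {Ω : Type*} [MeasurableSpace Ω] (P : Measure Ω) [IsProbabilityMeasure P] (U V : Ω → ℝ),
      HasLaw U (SpectralAug.gammaScale (1 / 2) 2) P →
      HasLaw V
        (SpectralAug.gammaScale (SpectralAug.alpha σ k i) (2 * SpectralAug.gam σ k i)) P →
      IndepFun U V P →
      HasLaw (fun ω => U ω / (U ω + V ω))
        (volume.withDensity fun z => ENNReal.ofReal
          (SpectralAug.xPDF (SpectralAug.alpha σ k i) (SpectralAug.gam σ k i) z)) P ∧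
      Integrable (fun ω => U ω / (U ω + V ω)) P ∧
      ∫ ω, U ω / (U ω + V ω) ∂P =
        ∫ z in (0 : ℝ)..1,
          z * SpectralAug.xPDF (SpectralAug.alpha σ k i) (SpectralAug.gam σ k i) z) ∧
    -- the density is nonnegative and has support `[0, 1]`
    (∀ z, 0 ≤ SpectralAug.xPDF (SpectralAug.alpha σ k i) (SpectralAug.gam σ k i) z) ∧
    tsupport (SpectralAug.xPDF (SpectralAug.alpha σ k i) (SpectralAug.gam σ k i)) = Icc 0 1 ∧
    -- the closed form
    IntervalIntegrable
      (fun z => z * SpectralAug.xPDF (SpectralAug.alpha σ k i) (SpectralAug.gam σ k i) z)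
      volume 0 1 ∧
    ((∫ z in (0 : ℝ)..1,
        z * SpectralAug.xPDF (SpectralAug.alpha σ k i) (SpectralAug.gam σ k i) z : ℝ) : ℂ) =
      ((SpectralAug.gam σ k i ^ (1 / 2 : ℝ) *
        (Real.Gamma (3 / 2) * Real.Gamma (1 / 2 + SpectralAug.alpha σ k i) /
          (Real.Gamma (1 / 2) * Real.Gamma (3 / 2 + SpectralAug.alpha σ k i))) : ℝ) : ℂ) *
        SpectralAug.hyp2F1 (3 / 2) (1 / 2 + SpectralAug.alpha σ k i)
          (3 / 2 + SpectralAug.alpha σ k i) (1 - SpectralAug.gam σ k i) ∧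
    -- if `vᵢ` itself has the Gamma law, then the formula gives `λᵢ(k)`
    (HasLaw (SpectralAug.vVar σ k i)
        (SpectralAug.gammaScale (SpectralAug.alpha σ k i) (2 * SpectralAug.gam σ k i))
        (SpectralAug.stdNormal d) →
      SpectralAug.lam σ k i =
        ∫ z in (0 : ℝ)..1,
          z * SpectralAug.xPDF (SpectralAug.alpha σ k i) (SpectralAug.gam σ k i) z) := by
  have hα := SpectralAug.alpha_pos hβ
  have hγ := SpectralAug.gam_pos hβi hβ
  have hu := SpectralAug.hasLaw_uVar i
  have huv := SpectralAug.indepFun_uVar_vVar σ k i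
  refine ⟨hα, hγ, SpectralAug.lam_eq_integral_beta σ k i, SpectralAug.lam_eq_integral_div_add hβi,
    SpectralAug.integrable_uVar_div_add_vVar σ k i, hu, huv, SpectralAug.memLp_vVar σ k i,
    SpectralAug.memLp_id_gammaScale hα (mul_pos two_pos hγ),
    SpectralAug.integral_vVar_eq_integral_gammaScale hβi hβ,
    SpectralAug.variance_vVar_eq_variance_gammaScale hβi hβ, ?surrogate,
    SpectralAug.gammaRatioPDF_nonneg one_half_pos hα hγ,
    SpectralAug.tsupport_gammaRatioPDF one_half_pos hα hγ,
    SpectralAug.intervalIntegrable_mul_gammaRatioPDF one_half_pos hα hγ,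
    SpectralAug.integral_mul_xPDF hα hγ, fun hv => ?exact⟩
  case surrogate =>
    intro Ω _ P _ U V hU hV hUV
    exact ⟨SpectralAug.hasLaw_div_add one_half_pos hα hγ two_pos hU hV hUV,
      SpectralAug.integrable_div_add hU.aemeasurable hV.aemeasurable
        (SpectralAug.ae_nonneg_of_hasLaw_gammaScale hU)
        (SpectralAug.ae_nonneg_of_hasLaw_gammaScale hV),
      SpectralAug.integral_div_add one_half_pos hα hγ two_pos hU hV hUV⟩
  case exact =>
    rw [SpectralAug.lam_eq_integral_div_add hβi]
    exact SpectralAug.integral_div_add one_half_pos hα hγ two_pos hu hv huv
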